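/- Let $X$ be a Tychonoff space (a completely regular Hausdorff space). Let $C_p(X)$ be the set of all continuous functions $X\to\mathbb{R}$, and let $B_1(X)$ be the set of all Baire-one functions $X\to\mathbb{R}$, that is, of all pointwise limits of sequences of continuous real-valued functions on $X$; both sets carry the topology of pointwise convergence (the subspace topology from $\mathbb{R}^X$). Then the following conditions are equivalent: (1) $C_p(X)$ is $\kappa$-Fréchet-Urysohn: for every open set $U\subseteq C_p(X)$ and every $f\in\overline{U}$ there is a sequence of elements of $U$ that converges to $f$. (2) $B_1(X)$ is a Baire space: the intersection of any sequence of dense open subsets of $B_1(X)$ is dense in $B_1(X)$. -/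

import Mathlib

open Filter Topology

/-- A space `Y` is κ-Fréchet-Urysohn if every point of the closure of an open set `U` is the limit
of a sequence of points of `U`. -/
def IsKappaFrechetUrysohn (Y : Type*) [TopologicalSpace Y] : Prop :=
  ∀ U : Set Y, IsOpen U → ∀ y ∈ closure U, ∃ u : ℕ → Y, (∀ n, u n ∈ U) ∧ Tendsto u atTop (𝓝 y)

/-- The space `C_p(X)` of continuous real-valued functions on `X`, with the topology of pointwise
convergence, that is, the subspace topology from the product `X → ℝ`. -/
abbrev Cp (X : Type*) [TopologicalSpace X] : Type _ :=
  {f : X → ℝ // Continuous f}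

/-- A real-valued function is Baire-one if it is the pointwise limit of a sequence of continuous
real-valued functions. -/
def IsBaireOne {X : Type*} [TopologicalSpace X] (f : X → ℝ) : Prop :=
  ∃ F : ℕ → X → ℝ, (∀ n, Continuous (F n)) ∧ ∀ x, Tendsto (fun n => F n x) atTop (𝓝 (f x))

/-- The space `B_1(X)` of Baire-one functions on `X`, with the topology of pointwise convergence,
that is, the subspace topology from the product `X → ℝ`. -/
abbrev BaireOne (X : Type*) [TopologicalSpace X] : Type _ :=
  {f : X → ℝ // IsBaireOne f}

/-! Both conditions are equivalent to `HasStronglyPointFiniteSubsequences X`.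

To derive it, note that disjoint finite sets eventually avoid any given finite set, so finitely many
prescribed values do not prevent a continuous function from being large on some late `D n`. Either
hypothesis then yields a pointwise convergent sequence of continuous functions that are large on a
subsequence of the `D n`. Their open superlevel sets are the expansion, and convergence makes it
point-finite.

To use it, build finite sets `A n` increasingly, each recording the points that control membership
in the open sets at hand. The differences `A (n + 1) \ A n` are disjoint, so a subsequence has a
point-finite open expansion `W`. By `exists_continuous_perturbation`, large corrections can be
confined to `W k`; each point sees finitely many of them, and pointwise limits exist. -/

/-- Every pairwise disjoint sequence of finite sets has a strongly point-finite subsequence, that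
is, a subsequence with a point-finite open expansion. -/
def HasStronglyPointFiniteSubsequences (X : Type*) [TopologicalSpace X] : Prop :=
  ∀ D : ℕ → Finset X, (∀ m n, m < n → Disjoint (D m) (D n)) →
    ∃ φ : ℕ → ℕ, StrictMono φ ∧ ∃ U : ℕ → Set X, (∀ k, IsOpen (U k)) ∧
      (∀ k, ∀ x ∈ D (φ k), x ∈ U k) ∧ ∀ x, ∀ᶠ k in atTop, x ∉ U k

theorem Continuous.isBaireOne {X : Type*} [TopologicalSpace X] {f : X → ℝ} (hf : Continuous f) :
    IsBaireOne f :=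
  ⟨fun _ => f, fun _ => hf, fun _ => tendsto_const_nhds⟩

/-! ### Basic open sets of pointwise convergence and disjoint finite sets -/

section Pointwise

variable {X : Type*}

theorem isOpen_setOf_forall_abs_sub_lt (P : (X → ℝ) → Prop) (f : X → ℝ) (F : Finset X) (ε : ℝ) :
    IsOpen {g : {g : X → ℝ // P g} | ∀ x ∈ F, |g.1 x - f x| < ε} := by
  have : {g : {g : X → ℝ // P g} | ∀ x ∈ F, |g.1 x - f x| < ε} =
      ⋂ x ∈ F, {g : {g : X → ℝ // P g} | |g.1 x - f x| < ε} := by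
    ext; simp
  rw [this]
  refine isOpen_biInter_finset fun x _ => isOpen_lt ?_ continuous_const
  have : Continuous fun g : {g : X → ℝ // P g} => g.1 x :=
    (continuous_apply x).comp continuous_subtype_val
  exact (this.sub continuous_const).abs

theorem isOpen_setOf_forall_lt (P : (X → ℝ) → Prop) (F : Finset X) (c : ℝ) :
    IsOpen {g : {g : X → ℝ // P g} | ∀ x ∈ F, c < g.1 x} := by
  have : {g : {g : X → ℝ // P g} | ∀ x ∈ F, c < g.1 x} =
      ⋂ x ∈ F, {g : {g : X → ℝ // P g} | c < g.1 x} := by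
    ext; simp
  rw [this]
  exact isOpen_biInter_finset fun x _ => isOpen_lt continuous_const
    ((continuous_apply x).comp continuous_subtype_val)

theorem IsOpen.exists_finset_forall_abs_sub_lt {P : (X → ℝ) → Prop} {O : Set {g : X → ℝ // P g}}
    (hO : IsOpen O) {f : {g : X → ℝ // P g}} (hf : f ∈ O) :
    ∃ F : Finset X, ∃ ε > 0, ∀ g : {g : X → ℝ // P g}, (∀ x ∈ F, |g.1 x - f.1 x| < ε) → g ∈ O := by
  obtain ⟨V, hV, rfl⟩ := isOpen_induced_iff.1 hO
  obtain ⟨F, u, hu, hFV⟩ := isOpen_pi_iff.1 hV f.1 hf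
  have : ∀ x, ∃ ε > 0, x ∈ F → Metric.ball (f.1 x) ε ⊆ u x := by
    intro x
    by_cases hx : x ∈ F
    · obtain ⟨ε, hε, h⟩ := Metric.isOpen_iff.1 (hu x hx).1 _ (hu x hx).2
      exact ⟨ε, hε, fun _ => h⟩
    · exact ⟨1, one_pos, fun h => absurd h hx⟩
  choose e he hball using this
  have hev : ∀ᶠ ε : ℝ in 𝓝[>] 0, ∀ x ∈ F, ε < e x :=
    (Filter.eventually_all_finset F).2 fun x _ =>
      eventually_nhdsWithin_of_eventually_nhds (eventually_lt_nhds (he x))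
  obtain ⟨ε, hlt, hpos⟩ := (hev.and self_mem_nhdsWithin).exists
  refine ⟨F, ε, hpos, fun g hg => hFV fun x hx => hball x hx ?_⟩
  rw [Metric.mem_ball, Real.dist_eq]
  exact (hg x hx).trans (hlt x hx)

theorem eventually_disjoint_of_pairwise_disjoint {α : Type*} {D : ℕ → Finset α}
    (hD : ∀ m n, m < n → Disjoint (D m) (D n)) (F : Finset α) :
    ∀ᶠ n in atTop, ∀ x ∈ F, x ∉ D n := by
  refine (Filter.eventually_all_finset F).2 fun x _ => ?_
  by_cases h : ∃ n, x ∈ D n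
  · obtain ⟨n, hn⟩ := h
    filter_upwards [eventually_gt_atTop n] with m hm hx
    exact Finset.disjoint_left.1 (hD n m hm) hn hx
  · exact Eventually.of_forall fun n hn => h ⟨n, hn⟩

theorem Monotone.disjoint_sdiff_succ {α : Type*} [DecidableEq α] {A : ℕ → Finset α}
    (hA : Monotone A) (m n : ℕ) (hmn : m < n) :
    Disjoint (A (m + 1) \ A m) (A (n + 1) \ A n) := by
  rw [Finset.disjoint_left]
  intro x hx hx'
  exact (Finset.mem_sdiff.1 hx').2 (hA hmn (Finset.mem_sdiff.1 hx).1)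

end Pointwise

/-! ### Continuous interpolation on finite sets -/

section Interpolation

variable {X : Type*} [TopologicalSpace X] [T35Space X]

theorem exists_continuous_eq_on_finset (B : Finset X) {W : Set X} (hW : IsOpen W)
    (hBW : ∀ x ∈ B, x ∈ W) (v : X → ℝ) {C : ℝ} (hC : 0 ≤ C) (hv : ∀ x ∈ B, |v x| ≤ C) :
    ∃ s : X → ℝ, Continuous s ∧ (∀ x ∈ B, s x = v x) ∧ (∀ x, x ∉ W → s x = 0) ∧
      ∀ x, |s x| ≤ C := by
  classical
  have bump : ∀ y, ∃ ψ : X → ℝ, Continuous ψ ∧ (y ∈ B → ψ y = 1) ∧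
      (∀ x ∈ B, x ≠ y → ψ x = 0) ∧ ∀ x, x ∉ W → ψ x = 0 := by
    intro y
    by_cases hy : y ∈ B
    · have hK : IsClosed (Wᶜ ∪ (↑(B.erase y) : Set X)) :=
        hW.isClosed_compl.union (B.erase y).finite_toSet.isClosed
      obtain ⟨ψ, hψ, h0, h1⟩ := CompletelyRegularSpace.completely_regular y _ hK
        (by simp [hBW y hy])
      refine ⟨fun x => 1 - ψ x, by fun_prop, fun _ => by simp [h0], fun x hx hxy => ?_,
        fun x hx => ?_⟩
      · have := h1 (Or.inr (by simp [hx, hxy]) : x ∈ Wᶜ ∪ (↑(B.erase y) : Set X))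
        simp [this]
      · have := h1 (Or.inl hx : x ∈ Wᶜ ∪ (↑(B.erase y) : Set X))
        simp [this]
    · exact ⟨0, continuous_const, fun h => absurd h hy, fun _ _ _ => rfl, fun _ _ => rfl⟩
  choose ψ hψ h1 h0 hW0 using bump
  refine ⟨fun x => max (-C) (min (∑ y ∈ B, v y * ψ y x) C), ?_, ?_, ?_, ?_⟩
  · have : Continuous fun x => ∑ y ∈ B, v y * ψ y x :=
      continuous_finsetSum _ fun y _ => continuous_const.mul (hψ y)
    fun_prop
  · intro x hx
    have : ∑ y ∈ B, v y * ψ y x = v x := by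
      rw [Finset.sum_eq_single_of_mem x hx fun y _ hyx => by simp [h0 y x hx hyx.symm], h1 x hx,
        mul_one]
    simp only [this]
    have := abs_le.1 (hv x hx)
    rw [min_eq_left this.2, max_eq_right this.1]
  · intro x hx
    have : ∑ y ∈ B, v y * ψ y x = 0 := Finset.sum_eq_zero fun y _ => by simp [hW0 y x hx]
    simp [this, hC]
  · intro x
    exact abs_le.2 ⟨le_max_left _ _, max_le (by linarith) (min_le_right _ _)⟩

theorem exists_continuous_forall_mem_eq (B : Finset X) (v : X → ℝ) :
    ∃ s : X → ℝ, Continuous s ∧ (∀ x ∈ B, s x = v x) ∧ ∃ C, ∀ x, |s x| ≤ C := by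
  obtain ⟨s, hs, h1, -, h2⟩ := exists_continuous_eq_on_finset B isOpen_univ (fun _ _ => trivial) v
    (Finset.sum_nonneg fun x _ => abs_nonneg (v x))
    (fun x hx => Finset.single_le_sum (f := fun x => |v x|) (fun x _ => abs_nonneg (v x)) hx)
  exact ⟨s, hs, h1, _, h2⟩

/-- Two corrections are added to `f`: one, bounded by `η` everywhere, repairs the values on `A`; the
other, possibly large, vanishes on `A` and off `W` and repairs the rest of `B`. -/
theorem exists_continuous_perturbation [DecidableEq X] {f : X → ℝ} (hf : Continuous f) (h : X → ℝ)
    (A B : Finset X) {W : Set X} (hW : IsOpen W) (hBW : ∀ x ∈ B \ A, x ∈ W) {η : ℝ} (hη : 0 ≤ η)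
    (hA : ∀ x ∈ A, |h x - f x| ≤ η) :
    ∃ g : X → ℝ, Continuous g ∧ (∀ x ∈ A ∪ B, g x = h x) ∧ (∀ x, x ∉ W → |g x - f x| ≤ η) ∧
      ∃ C, ∀ x, |g x - f x| ≤ C := by
  obtain ⟨r, hr, hrA, -, hrη⟩ := exists_continuous_eq_on_finset A isOpen_univ (fun _ _ => trivial)
    (fun x => h x - f x) hη hA
  obtain ⟨s, hs, hsB, hsW, hsC⟩ := exists_continuous_eq_on_finset (B \ A)
    (W := W ∩ (↑A : Set X)ᶜ) (hW.inter A.finite_toSet.isClosed.isOpen_compl)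
    (fun x hx => ⟨hBW x hx, by simpa using (Finset.mem_sdiff.1 hx).2⟩)
    (fun x => h x - f x - r x)
    (Finset.sum_nonneg fun x _ => abs_nonneg (h x - f x - r x))
    (fun x hx => Finset.single_le_sum (f := fun x => |h x - f x - r x|)
      (fun x _ => abs_nonneg _) hx)
  refine ⟨fun x => f x + r x + s x, by fun_prop, fun x hx => ?_, fun x hx => ?_,
    η + ∑ x ∈ B \ A, |h x - f x - r x|, fun x => ?_⟩
  · by_cases hxA : x ∈ A
    · simp [hrA x hxA, hsW x (fun h => h.2 hxA)]
    · have hxB : x ∈ B \ A := by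
        rw [Finset.mem_sdiff]
        exact ⟨(Finset.mem_union.1 hx).resolve_left hxA, hxA⟩
      simp [hsB x hxB]
  · simpa [hsW x (fun h => hx h.1)] using hrη x
  · rw [show f x + r x + s x - f x = r x + s x by ring]
    exact (abs_add_le _ _).trans (add_le_add (hrη x) (hsC x))

end Interpolation

/-! ### Point-finite expansions and the κ-Fréchet-Urysohn property -/

section KappaFrechetUrysohn

variable {X : Type*} [TopologicalSpace X] [T35Space X]

theorem IsKappaFrechetUrysohn.hasStronglyPointFiniteSubsequences
    (hX : IsKappaFrechetUrysohn (Cp X)) : HasStronglyPointFiniteSubsequences X := by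
  classical
  intro D hD
  -- Past the trivial case the late `D n` are nonempty; a point of `D n` then prevents the index `n`
  -- from recurring infinitely often, since `u k` tends to 0 there.
  by_cases hemp : ∃ᶠ n in atTop, D n = ∅
  · obtain ⟨φ, hφ, hφD⟩ := extraction_of_frequently_atTop hemp
    exact ⟨φ, hφ, fun _ => ∅, fun _ => isOpen_empty, fun k x hx => by simp [hφD k] at hx,
      fun x => by simp⟩
  obtain ⟨N, hN⟩ := eventually_atTop.1 (not_frequently.1 hemp)
  let U : Set (Cp X) := ⋃ n ≥ N, {f | ∀ x ∈ D n, 1 < f.1 x}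
  have hU : IsOpen U := isOpen_biUnion fun n _ => isOpen_setOf_forall_lt _ (D n) 1
  have h0 : (⟨fun _ => 0, continuous_const⟩ : Cp X) ∈ closure U := by
    rw [mem_closure_iff]
    intro O hO h0O
    obtain ⟨F, ε, hε, hF⟩ := hO.exists_finset_forall_abs_sub_lt h0O
    obtain ⟨n, hFn, hn⟩ :=
      ((eventually_disjoint_of_pairwise_disjoint hD F).and (eventually_ge_atTop N)).exists
    obtain ⟨s, hs, hsv, -⟩ := exists_continuous_forall_mem_eq (F ∪ D n)
      (fun x => if x ∈ D n then (2 : ℝ) else 0)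
    refine ⟨⟨s, hs⟩, hF _ fun x hx => ?_, Set.mem_biUnion hn fun x hx => ?_⟩
    · simpa [hsv x (Finset.mem_union_left _ hx), hFn x hx] using hε
    · simp [hsv x (Finset.mem_union_right _ hx), hx]
  obtain ⟨u, huU, hu⟩ := hX U hU _ h0
  have hlim : ∀ x, ∀ᶠ k in atTop, (u k).1 x < 1 := fun x =>
    (((continuous_apply x).comp continuous_subtype_val).tendsto _ |>.comp hu).eventually_lt_const
      (one_pos : (0 : ℝ) < 1)
  have hmem : ∀ k, ∃ n ≥ N, ∀ x ∈ D n, 1 < (u k).1 x := fun k => by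
    simpa [U] using huU k
  choose ν hνN hν using hmem
  have hνtop : Tendsto ν atTop atTop := by
    refine tendsto_atTop.2 fun b => ?_
    have hne : ∀ n, ∀ᶠ k in atTop, ν k ≠ n := by
      intro n
      by_cases hn : N ≤ n
      · obtain ⟨x, hx⟩ := Finset.nonempty_iff_ne_empty.2 (hN n hn)
        filter_upwards [hlim x] with k hk hkn
        exact hk.not_gt (hν k x (hkn ▸ hx))
      · exact Eventually.of_forall fun k hk => hn (hk ▸ hνN k)
    filter_upwards [(Filter.eventually_all_finset (Finset.range b)).2 fun n _ => hne n] with k hk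
    by_contra! hlt
    exact hk _ (Finset.mem_range.2 hlt) rfl
  obtain ⟨ψ, hψ, hψν⟩ := strictMono_subseq_of_tendsto_atTop hνtop
  exact ⟨ν ∘ ψ, hψν, fun k => {x | 1 < (u (ψ k)).1 x},
    fun k => isOpen_lt continuous_const (u (ψ k)).2, fun k x hx => hν _ x hx,
    fun x => (hψ.tendsto_atTop.eventually (hlim x)).mono fun k hk => by simpa using hk.le⟩

theorem HasStronglyPointFiniteSubsequences.isKappaFrechetUrysohn
    (hX : HasStronglyPointFiniteSubsequences X) : IsKappaFrechetUrysohn (Cp X) := by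
  classical
  intro U hU f hf
  have key : ∀ (A : Finset X) (n : ℕ), ∃ g : Cp X, ∃ F : Finset X,
      (∀ x ∈ A, |g.1 x - f.1 x| ≤ 1 / ((n : ℝ) + 1)) ∧
      ∀ g' : Cp X, (∀ x ∈ F, g'.1 x = g.1 x) → g' ∈ U := by
    intro A n
    obtain ⟨g, hgA, hgU⟩ := mem_closure_iff.1 hf _
      (isOpen_setOf_forall_abs_sub_lt _ f.1 A (1 / ((n : ℝ) + 1)))
      (fun x _ => by simpa using (by positivity : (0 : ℝ) < n + 1))
    obtain ⟨F, ε, hε, hF⟩ := hU.exists_finset_forall_abs_sub_lt hgU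
    exact ⟨g, F, fun x hx => (hgA x hx).le, fun g' hg' => hF g' fun x hx => by
      simpa [hg' x hx] using hε⟩
  choose g F hgA hgF using key
  let A : ℕ → Finset X := fun n => Nat.rec ∅ (fun n A => A ∪ F A n) n
  have hAs : ∀ n, A (n + 1) = A n ∪ F (A n) n := fun n => rfl
  have hA : Monotone A := monotone_nat_of_le_succ fun n => by
    rw [hAs]; exact Finset.subset_union_left
  obtain ⟨φ, hφ, W, hWo, hDW, hWfin⟩ := hX _ hA.disjoint_sdiff_succ
  have hpert := fun k => exists_continuous_perturbation f.2 (g (A (φ k)) (φ k)).1 (A (φ k))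
    (A (φ k + 1)) (hWo k) (hDW k) (by positivity) (hgA (A (φ k)) (φ k))
  choose u hu huB huW _ using hpert
  refine ⟨fun k => ⟨u k, hu k⟩, fun k => hgF (A (φ k)) (φ k) _ fun x hx => huB k x ?_, ?_⟩
  · rw [hAs]; simp [hx]
  · rw [tendsto_subtype_rng, tendsto_pi_nhds]
    intro x
    rw [tendsto_iff_dist_tendsto_zero]
    refine squeeze_zero' (Eventually.of_forall fun _ => dist_nonneg) ((hWfin x).mono fun k hk => ?_)
      (tendsto_one_div_add_atTop_nhds_zero_nat.comp hφ.tendsto_atTop)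
    exact huW k x hk

end KappaFrechetUrysohn

/-! ### Point-finite expansions and the Baire property -/

section BaireOne

variable {X : Type*} [TopologicalSpace X] [T35Space X]

theorem BaireOne.hasStronglyPointFiniteSubsequences [BaireSpace (BaireOne X)] :
    HasStronglyPointFiniteSubsequences X := by
  classical
  intro D hD
  let G : ℕ → Set (BaireOne X) := fun m => ⋃ n ≥ m, {f | ∀ x ∈ D n, (n : ℝ) < f.1 x}
  have hGo : ∀ m, IsOpen (G m) := fun m =>
    isOpen_biUnion fun n _ => isOpen_setOf_forall_lt _ (D n) n
  have hGd : ∀ m, Dense (G m) := by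
    intro m f
    rw [mem_closure_iff]
    intro O hO hfO
    obtain ⟨F, ε, hε, hF⟩ := hO.exists_finset_forall_abs_sub_lt hfO
    obtain ⟨n, hFn, hn⟩ :=
      ((eventually_disjoint_of_pairwise_disjoint hD F).and (eventually_ge_atTop m)).exists
    obtain ⟨s, hs, hsv, -⟩ := exists_continuous_forall_mem_eq (F ∪ D n)
      (fun x => if x ∈ D n then (n + 1 : ℝ) else f.1 x)
    refine ⟨⟨s, hs.isBaireOne⟩, hF _ fun x hx => ?_, Set.mem_biUnion hn fun x hx => ?_⟩
    · simpa [hsv x (Finset.mem_union_left _ hx), hFn x hx] using hε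
    · simp [hsv x (Finset.mem_union_right _ hx), hx]
  have : Nonempty (BaireOne X) := ⟨⟨fun _ => 0, continuous_const.isBaireOne⟩⟩
  obtain ⟨f, hf⟩ := (dense_iInter_of_isOpen_nat hGo hGd).nonempty
  have hfreq : ∃ᶠ n : ℕ in atTop, ∀ x ∈ D n, (n : ℝ) < f.1 x := by
    rw [frequently_atTop]
    intro m
    simpa [G] using Set.mem_iInter.1 hf m
  obtain ⟨φ, hφ, hφD⟩ := extraction_of_frequently_atTop hfreq
  obtain ⟨p, hp, hpf⟩ := f.2
  have hi : ∀ k, ∃ i ≥ k, ∀ x ∈ D (φ k), (φ k : ℝ) < p i x := by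
    intro k
    have := (Filter.eventually_all_finset (D (φ k))).2 fun x hx =>
      (hpf x).eventually_const_lt (hφD k x hx)
    obtain ⟨i, h1, h2⟩ := (this.and (eventually_ge_atTop k)).exists
    exact ⟨i, h2, h1⟩
  choose i hik hi using hi
  refine ⟨φ, hφ, fun k => {x | (φ k : ℝ) < p (i k) x},
    fun k => isOpen_lt continuous_const (hp _), hi, fun x => ?_⟩
  -- The values `p (i k) x` converge to `f x`, whereas the thresholds `φ k` are unbounded.
  have hitop : Tendsto i atTop atTop := tendsto_atTop_mono hik tendsto_id
  have h1 := ((hpf x).comp hitop).eventually_lt_const (lt_add_one (f.1 x))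
  have h2 := (tendsto_natCast_atTop_atTop.comp hφ.tendsto_atTop).eventually_ge_atTop (f.1 x + 1)
  filter_upwards [h1, h2] with k h1 h2
  simpa using h1.le.trans h2

/-- A dense open set of Baire-one functions can be reached from all functions that are bounded by
`M` on `A` by perturbations whose membership is witnessed by one finite set. -/
theorem exists_finset_forall_exists_mem_of_dense {G : Set (BaireOne X)} (hGo : IsOpen G)
    (hGd : Dense G) (A : Finset X) {M : ℝ} (hM : 0 ≤ M) {δ : ℝ} (hδ : 0 < δ) :
    ∃ B : Finset X, ∀ f : X → ℝ, (∀ x ∈ A, |f x| ≤ M) → ∃ h : X → ℝ, ∃ ε > 0,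
      (∀ x ∈ A, |h x - f x| ≤ δ) ∧
      ∀ g : BaireOne X, (∀ x ∈ B, |g.1 x - h x| < ε) → g ∈ G := by
  classical
  have key : ∀ v : A → ℝ, ∃ h : X → ℝ, ∃ F : Finset X, ∃ ε > 0, (∀ x : A, |h x - v x| < δ / 2) ∧
      ∀ g : BaireOne X, (∀ x ∈ F, |g.1 x - h x| < ε) → g ∈ G := by
    intro v
    obtain ⟨s, hs, hsv, -⟩ := exists_continuous_forall_mem_eq A
      (fun x => if hx : x ∈ A then v ⟨x, hx⟩ else 0)
    obtain ⟨h, hhs, hhG⟩ := hGd.inter_open_nonempty _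
      (isOpen_setOf_forall_abs_sub_lt IsBaireOne s A (δ / 2))
      ⟨⟨s, hs.isBaireOne⟩, fun x _ => by simpa using hδ⟩
    obtain ⟨F, ε, hε, hF⟩ := hGo.exists_finset_forall_abs_sub_lt hhG
    refine ⟨h.1, F, ε, hε, fun x => ?_, hF⟩
    simpa [hsv x x.2] using hhs x x.2
  choose h F ε hε hhv hF using key
  -- The values on `A` range over a compact cube; a finite `δ / 2`-net of it makes `B` independent
  -- of `f`.
  obtain ⟨t, ht, hcov⟩ := Metric.totallyBounded_iff.1
    (isCompact_closedBall (0 : A → ℝ) M).totallyBounded (δ / 2) (half_pos hδ)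
  refine ⟨ht.toFinset.biUnion F, fun f hf => ?_⟩
  have hfM : (fun x : A => f x) ∈ Metric.closedBall (0 : A → ℝ) M := by
    rw [mem_closedBall_zero_iff, pi_norm_le_iff_of_nonneg hM]
    exact fun x => hf x x.2
  obtain ⟨v, hvt, hv⟩ := Set.mem_iUnion₂.1 (hcov hfM)
  refine ⟨h v, ε v, hε v, fun x hx => ?_, fun g hg => hF v g fun x hx => hg x ?_⟩
  · have h1 := hhv v ⟨x, hx⟩
    have h2 := (dist_le_pi_dist (fun x : A => f x) v ⟨x, hx⟩).trans_lt (Metric.mem_ball.1 hv)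
    rw [Real.dist_eq, abs_sub_comm] at h2
    have := abs_sub_le (h v x) (v ⟨x, hx⟩) (f x)
    dsimp only at h1 h2
    linarith
  · exact Finset.mem_biUnion.2 ⟨v, ht.mem_toFinset.2 hvt, hx⟩

/-- Halving gives `ε n / 4 ≤ (ε n - ε (n + 1)) / 2`, so the bounds telescope. -/
theorem abs_sub_le_of_forall_abs_succ_sub_le {a ε : ℕ → ℝ} {k : ℕ}
    (hε : ∀ n, ε (n + 1) ≤ ε n / 2) (h : ∀ n ≥ k, |a (n + 1) - a n| ≤ ε n / 4) :
    ∀ n ≥ k, |a n - a k| ≤ (ε k - ε n) / 2 := by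
  intro n hn
  induction n, hn using Nat.le_induction with
  | base => simp
  | succ n hn ih =>
    have := abs_sub_le (a (n + 1)) (a n) (a k)
    linarith [h n hn, hε n]

theorem HasStronglyPointFiniteSubsequences.baireSpace
    (hX : HasStronglyPointFiniteSubsequences X) : BaireSpace (BaireOne X) := by
  classical
  refine ⟨fun G hGo hGd => ?_⟩
  intro f₀
  rw [mem_closure_iff]
  intro O hO hf₀
  obtain ⟨F₀, e₀, he₀, hF₀⟩ := hO.exists_finset_forall_abs_sub_lt hf₀
  obtain ⟨s₀, hs₀, hs₀f, hs₀b⟩ := exists_continuous_forall_mem_eq F₀ f₀.1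
  choose B hB using fun (i : ℕ) (A : Finset X) (m : ℕ) =>
    exists_finset_forall_exists_mem_of_dense (hGo i) (hGd i) A m.cast_nonneg
      (Nat.one_div_pos_of_nat (α := ℝ) (n := m))
  -- Stage `m` provides for every `G i` with `i ≤ m`, for values bounded by `m` and tolerance `1 /
  -- (m + 1)`; thus any late enough stage can serve `G k`.
  let A : ℕ → Finset X := fun n =>
    Nat.rec F₀ (fun m A => A ∪ (Finset.range (m + 1)).biUnion fun i => B i A m) n
  have hAs : ∀ m, A (m + 1) = A m ∪ (Finset.range (m + 1)).biUnion fun i => B i (A m) m :=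
    fun m => rfl
  have hA : Monotone A := monotone_nat_of_le_succ fun n => by
    rw [hAs]; exact Finset.subset_union_left
  obtain ⟨φ, hφ, W, hWo, hDW, hWfin⟩ := hX _ hA.disjoint_sdiff_succ
  -- A state is a function, a radius and an index into `W`. Boundedness lets a stage `φ l` dominate
  -- the function on `A (φ l)`, whatever that set is.
  let S := {s : (X → ℝ) × ℝ × ℕ // Continuous s.1 ∧ (∃ C, ∀ x, |s.1 x| ≤ C) ∧ 0 < s.2.1}
  have step : ∀ (k : ℕ) (s : S), ∃ s' : S, s'.1.2.1 ≤ s.1.2.1 / 2 ∧ s.1.2.2 < s'.1.2.2 ∧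
      (∀ x, x ∉ W s'.1.2.2 → |s'.1.1 x - s.1.1 x| ≤ s.1.2.1 / 4) ∧
      (∀ x ∈ A (φ s'.1.2.2), |s'.1.1 x - s.1.1 x| ≤ s.1.2.1 / 4) ∧
      ∀ g : BaireOne X, (∀ x ∈ A (φ s'.1.2.2 + 1), |g.1 x - s'.1.1 x| < s'.1.2.1) → g ∈ G k := by
    rintro k ⟨⟨f, ε, j⟩, hf, ⟨C, hC⟩, hε⟩
    dsimp only at hf hC hε ⊢
    have h1 := (tendsto_natCast_atTop_atTop.comp hφ.tendsto_atTop).eventually_ge_atTop C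
    have h2 := (tendsto_one_div_add_atTop_nhds_zero_nat.comp hφ.tendsto_atTop).eventually_le_const
      (by positivity : 0 < ε / 4)
    obtain ⟨l, h1, h2, hjl, hkl⟩ := (h1.and (h2.and ((eventually_gt_atTop j).and
      (hφ.tendsto_atTop.eventually_ge_atTop k)))).exists
    dsimp only [Function.comp] at h1 h2
    obtain ⟨h, e, he, hhf, hhG⟩ := hB k (A (φ l)) (φ l) f fun x _ => (hC x).trans h1
    have hhf' : ∀ x ∈ A (φ l), |h x - f x| ≤ ε / 4 := fun x hx => (hhf x hx).trans h2
    obtain ⟨g, hg, hgh, hgW, C', hC'⟩ := exists_continuous_perturbation hf h (A (φ l))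
      (A (φ l + 1)) (hWo l) (hDW l) (by positivity) hhf'
    refine ⟨⟨⟨g, min e (ε / 2), l⟩, hg, ⟨C' + C, fun x => ?_⟩, lt_min he (half_pos hε)⟩,
      min_le_right _ _, hjl, hgW, fun x hx => ?_, fun u hu => hhG u fun x hx => ?_⟩
    · have := abs_add_le (g x - f x) (f x)
      rw [sub_add_cancel] at this
      exact this.trans (add_le_add (hC' x) (hC x))
    · simpa only [hgh x (Finset.mem_union_left _ hx)] using hhf' x hx
    · have hxA : x ∈ A (φ l + 1) := by
        rw [hAs]
        exact Finset.mem_union_right _ (Finset.mem_biUnion.2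
          ⟨k, Finset.mem_range.2 (Nat.lt_succ_of_le hkl), hx⟩)
      have := (hu x hxA).trans_le (min_le_left _ _)
      simpa only [hgh x (Finset.mem_union_right _ hxA)] using this
  choose next hnext using step
  let σ : ℕ → S := fun n => Nat.rec ⟨⟨s₀, e₀, 0⟩, hs₀, hs₀b, he₀⟩ next n
  have hσ : ∀ k, σ (k + 1) = next k (σ k) := fun k => rfl
  let f : ℕ → X → ℝ := fun k => (σ k).1.1
  let ε : ℕ → ℝ := fun k => (σ k).1.2.1
  let j : ℕ → ℕ := fun k => (σ k).1.2.2
  have hfc : ∀ k, Continuous (f k) := fun k => (σ k).2.1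
  have hεpos : ∀ k, 0 < ε k := fun k => (σ k).2.2.2
  have hε : ∀ k, ε (k + 1) ≤ ε k / 2 := fun k => (hnext k (σ k)).1
  have hj : StrictMono j := strictMono_nat_of_lt_succ fun k => (hnext k (σ k)).2.1
  have hfW : ∀ k x, x ∉ W (j (k + 1)) → |f (k + 1) x - f k x| ≤ ε k / 4 :=
    fun k => (hnext k (σ k)).2.2.1
  have hfA : ∀ k, ∀ x ∈ A (φ (j (k + 1))), |f (k + 1) x - f k x| ≤ ε k / 4 :=
    fun k => (hnext k (σ k)).2.2.2.1
  have hfG : ∀ k, ∀ g : BaireOne X,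
      (∀ x ∈ A (φ (j (k + 1)) + 1), |g.1 x - f (k + 1) x| < ε (k + 1)) → g ∈ G k :=
    fun k => (hnext k (σ k)).2.2.2.2
  have hε0 : Tendsto ε atTop (𝓝 0) := by
    have hle : ∀ k, ε k ≤ ε 0 * (1 / 2) ^ k := by
      intro k
      induction k with
      | zero => simp
      | succ k ih => rw [pow_succ]; linarith [hε k]
    refine squeeze_zero (fun k => (hεpos k).le) hle ?_
    simpa using (tendsto_pow_atTop_nhds_zero_of_lt_one (by norm_num : (0 : ℝ) ≤ 1 / 2)
      (by norm_num)).const_mul (ε 0)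
  have hdist : ∀ x k, (∀ n ≥ k, |f (n + 1) x - f n x| ≤ ε n / 4) →
      ∀ n ≥ k, |f n x - f k x| ≤ (ε k - ε n) / 2 := fun x k h =>
    abs_sub_le_of_forall_abs_succ_sub_le (a := fun n => f n x) hε h
  have hlim : ∀ x, ∃ y, Tendsto (fun k => f k x) atTop (𝓝 y) := by
    intro x
    obtain ⟨N, hN⟩ := eventually_atTop.1 (hj.tendsto_atTop.eventually (hWfin x))
    have hle : ∀ k ≥ N, ∀ n ≥ k, |f n x - f k x| ≤ ε k := fun k hk n hn =>
      (hdist x k (fun n hn => hfW n x (hN (n + 1) (by omega))) n hn).trans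
        (by linarith [hεpos k, hεpos n])
    refine cauchySeq_tendsto_of_complete (Metric.cauchySeq_iff'.2 fun r hr => ?_)
    obtain ⟨k, hk, hkN⟩ := ((hε0.eventually_lt_const hr).and (eventually_ge_atTop N)).exists
    exact ⟨k, fun n hn => (hle k hkN n hn).trans_lt hk⟩
  choose g hg using hlim
  have hgA : ∀ k x, (∀ n ≥ k, x ∈ A (φ (j (n + 1)))) → |g x - f k x| < ε k := by
    intro k x hx
    have : |g x - f k x| ≤ ε k / 2 := by
      refine le_of_tendsto ((hg x).sub_const (f k x)).abs ?_
      filter_upwards [eventually_ge_atTop k] with n hn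
      exact (hdist x k (fun n hn => hfA n x (hx n hn)) n hn).trans (by linarith [hεpos n])
    linarith [hεpos k]
  refine ⟨⟨g, f, hfc, hg⟩, hF₀ _ fun x hx => ?_, Set.mem_iInter.2 fun k => hfG k _ fun x hx => ?_⟩
  · have : |g x - s₀ x| < e₀ := hgA 0 x fun n _ => hA (Nat.zero_le _) hx
    rwa [hs₀f x hx] at this
  -- The points deciding membership in `G k` lie in all later `A (φ (j (n + 1)))`, where further
  -- corrections are small.
  · refine hgA (k + 1) x fun n hn => ?_
    have hlt : φ (j (k + 1)) < φ (j (n + 1)) := hφ (hj (Nat.succ_lt_succ hn))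
    exact hA (Nat.succ_le_of_lt hlt) hx

end BaireOne

theorem theorem1 (X : Type*) [TopologicalSpace X] [T35Space X] :
    IsKappaFrechetUrysohn (Cp X) ↔ BaireSpace (BaireOne X) :=
  ⟨fun h => h.hasStronglyPointFiniteSubsequences.baireSpace,
    fun _ => BaireOne.hasStronglyPointFiniteSubsequences.isKappaFrechetUrysohn⟩
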